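/- Let $\lambda_n$ ($n\ge 0$) and $\mu_n$ ($n\ge 1$) be positive real numbers, and let $X=(X_t)_{t\ge 0}$ be a birth-and-death process on $\{0,1,2,\dots\}$ with birth rates $\lambda_n$ and death rates $\mu_n$: a continuous-time Markov jump process which, independently of its past, stays in state $n$ for an exponential time with parameter $\lambda_n+\mu_n$ and then jumps to $n+1$ with probability $\lambda_n/(\lambda_n+\mu_n)$ and to $n-1$ with probability $\mu_n/(\lambda_n+\mu_n)$ (from $0$, where there are no deaths, it jumps to $1$ after an exponential time with parameter $\lambda_0$). If infinitely many jumps happen in finite time, the process is sent to a cemetery state from that explosion time on (minimal process). Write $\mathsf P_i$ for its law when started at $i$. The process is called recurrent if for every state $i$ the set $\{t\ge 0: X_t=i\}$ is unbounded $\mathsf P_i$-almost surely, and transient if for every state $i$ this set is bounded $\mathsf P_i$-almost surely. Let $\ln_{(1)}x=\ln x$ and $\ln_{(k)}x=\ln_{(k-1)}(\ln x)$ for $k\ge 2$; an empty sum is $0$. (a) The process is transient if there exist $c>1$, an integer $K\ge 1$ and $n_0$ such that for all $n>n_0$ $$\frac{\lambda_n}{\mu_n}\ \ge\ 1+\frac1n+\frac1n\sum_{k=1}^{K-1}\frac{1}{\prod_{j=1}^{k}\ln_{(j)}n}+\frac{c}{n\prod_{j=1}^{K}\ln_{(j)}n}.$$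 (b) The process is recurrent if there exist an integer $K\ge 1$ and $n_0$ such that for all $n>n_0$ $$\frac{\lambda_n}{\mu_n}\ \le\ 1+\frac1n+\frac1n\sum_{k=1}^{K}\frac{1}{\prod_{j=1}^{k}\ln_{(j)}n}.$$ -/

import Mathlib

open MeasureTheory
open scoped NNReal

noncomputable section

namespace BirthDeath

/-- The off-diagonal jump rates on the state space `ℕ`: a birth `i → i + 1` has rate `lam i`, a death
`i → i - 1` (possible only for `1 ≤ i`) has rate `mu i`. The value `mu 0` plays no role. -/
def rate (lam mu : ℕ → ℝ) (i j : ℕ) : ℝ :=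
  if j = i + 1 then lam i else if i = j + 1 then mu i else 0

/-- The total rate at which state `i` is left. -/
def exitRate (lam mu : ℕ → ℝ) (i : ℕ) : ℝ :=
  lam i + if i = 0 then 0 else mu i

/-- The transition probabilities of the embedded jump chain. -/
def jumpProb (lam mu : ℕ → ℝ) (i j : ℕ) : ℝ :=
  rate lam mu i j / exitRate lam mu i

/-- The time of the `n`-th jump, for the holding times `S 0, S 1, …`. -/
def jumpTime {Ω : Type*} (S : ℕ → Ω → ℝ) (n : ℕ) (ω : Ω) : ℝ :=
  ∑ k ∈ Finset.range n, S k ω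

/-- `Y` and `S` are, under the probability measure `P`, the jump chain and the holding times of a
birth-and-death process started at `i`: `Y` is a Markov chain with `Y 0 = i` and transition
probabilities `jumpProb`, and given `Y` the holding times `S k` are independent and exponentially
distributed with parameters `exitRate (Y k)`. This is expressed by the joint law of
`(Y 0, S 0), …, (Y n, S n)`, for every `n`. -/
structure IsJumpData {Ω : Type*} [MeasurableSpace Ω] (lam mu : ℕ → ℝ) (i : ℕ) (P : Measure Ω)
    (Y : ℕ → Ω → ℕ) (S : ℕ → Ω → ℝ) : Prop where
  measurable_chain : ∀ n, Measurable (Y n)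
  measurable_holding : ∀ n, Measurable (S n)
  law : ∀ (n : ℕ) (y : ℕ → ℕ) (t : ℕ → ℝ), (∀ k, 0 ≤ t k) →
    P {ω | ∀ k ≤ n, Y k ω = y k ∧ t k < S k ω} =
      if y 0 = i then
        ENNReal.ofReal
          ((∏ k ∈ Finset.range n, jumpProb lam mu (y k) (y (k + 1))) *
            ∏ k ∈ Finset.range (n + 1), Real.exp (-(exitRate lam mu (y k) * t k)))
      else 0

/-- `X`, with the family `P i` of probability measures (`P i` being the law of the process started
at `i`), is a (minimal) birth-and-death process with birth rates `lam` and death rates `mu`: it sits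
in `Y n` from the `n`-th to the `(n + 1)`-st jump time, and in the cemetery state `⊤` from the
explosion time `∑ S k` on, if that time is finite. -/
def IsBirthDeathProcess {Ω : Type*} [MeasurableSpace Ω] (lam mu : ℕ → ℝ) (P : ℕ → Measure Ω)
    (X : ℝ≥0 → Ω → WithTop ℕ) : Prop :=
  ∀ i, ∃ (Y : ℕ → Ω → ℕ) (S : ℕ → Ω → ℝ), IsJumpData lam mu i (P i) Y S ∧
    ∀ᵐ ω ∂(P i), ∀ t : ℝ≥0,
      (∀ n, jumpTime S n ω ≤ t → (t : ℝ) < jumpTime S (n + 1) ω → X t ω = (Y n ω : WithTop ℕ)) ∧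
      ((∀ n, jumpTime S n ω ≤ t) → X t ω = ⊤)

/-- Every state `i` is recurrent: started at `i`, the process is almost surely in `i` at arbitrarily
large times. -/
def IsRecurrent {Ω : Type*} [MeasurableSpace Ω] (P : ℕ → Measure Ω)
    (X : ℝ≥0 → Ω → WithTop ℕ) : Prop :=
  ∀ i : ℕ, ∀ᵐ ω ∂(P i), ¬ BddAbove {t : ℝ≥0 | X t ω = (i : WithTop ℕ)}

/-- Every state `i` is transient: started at `i`, the process almost surely makes all its
visits to `i` before some finite time. -/
def IsTransient {Ω : Type*} [MeasurableSpace Ω] (P : ℕ → Measure Ω)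
    (X : ℝ≥0 → Ω → WithTop ℕ) : Prop :=
  ∀ i : ℕ, ∀ᵐ ω ∂(P i), BddAbove {t : ℝ≥0 | X t ω = (i : WithTop ℕ)}

/-- The `k`-fold iterated natural logarithm. -/
def iterLog (k : ℕ) (x : ℝ) : ℝ := Real.log^[k] x

/-- The product of the first `k` iterated logarithms of `x`. -/
def logProd (k : ℕ) (x : ℝ) : ℝ := ∏ j ∈ Finset.Icc 1 k, iterLog j x

end BirthDeath

end

noncomputable section

namespace BirthDeath

open Filter Topology

/-! Let `r n` be the product of `mu k / lam k` over `1 ≤ k ≤ n` (`scaleDensity`). Its partial sums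
form the scale function of the jump chain, and the proof shows that the process is transient if `∑ r
n` converges and recurrent if it diverges.

The growth of `r` is settled by Kummer's test with `B = bertrand K`, that is, `B x = x log x ⋯
log^[K] x`. Its logarithmic derivative `B' / B` is exactly the sum of reciprocals in the theorem, so
the hypotheses say that `lam n / mu n` is at least `1 + B'/B + (c - 1)/B`, or at most `1 + B'/B`.
Since `B''` is eventually nonnegative and tends to `0`, `B (x + 1)` exceeds `B x + B' x` by a
nonnegative quantity tending to `0`. This gives `summable_of_bertrand_ratio` and
`not_summable_of_bertrand_ratio`.

If `∑ r n` converges, its tails give a nonnegative superharmonic function with a strict drop at `i`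
(`average_potential_add_le`). The expected number of visits to `i` is therefore finite, and
Borel–Cantelli applies.

If `∑ r n` diverges, kill the chain at a visit to `i` whenever the holding time there exceeds `1`.
The limiting survival probability yields a bounded function, harmonic off `i`, hence affine in the
unbounded scale function above `i`; boundedness forces it to vanish (`eq_zero_of_killed_harmonic`).
So almost surely `i` is visited infinitely often with holding times longer than `1`, which gives the
returns and excludes explosion at once. -/

/-- The Bertrand function `x * log x * ⋯ * log^[K] x`, defined by recursion through `log`. -/
def bertrand : ℕ → ℝ → ℝ
  | 0, x => x
  | K + 1, x => x * bertrand K (Real.log x)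

/-- The derivative of `bertrand K`, for large arguments. -/
def bertrandDeriv : ℕ → ℝ → ℝ
  | 0, _ => 1
  | K + 1, x => bertrand K (Real.log x) + bertrandDeriv K (Real.log x)

/-- The second derivative of `bertrand K`, for large arguments. -/
def bertrandDerivTwo : ℕ → ℝ → ℝ
  | 0, _ => 0
  | K + 1, x => (bertrandDeriv K (Real.log x) + bertrandDerivTwo K (Real.log x)) / x

/-! ### Positivity, derivatives and growth of the Bertrand functions -/

lemma eventually_bertrand_pos (K : ℕ) : ∀ᶠ x in atTop, 0 < bertrand K x := by
  induction K with
  | zero => exact eventually_gt_atTop 0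
  | succ K ih =>
    filter_upwards [eventually_gt_atTop 0, Real.tendsto_log_atTop.eventually ih] with x hx h
    exact mul_pos hx h

lemma eventually_bertrandDeriv_pos (K : ℕ) : ∀ᶠ x in atTop, 0 < bertrandDeriv K x := by
  induction K with
  | zero => exact Eventually.of_forall fun _ => one_pos
  | succ K ih =>
    filter_upwards [Real.tendsto_log_atTop.eventually ih,
      Real.tendsto_log_atTop.eventually (eventually_bertrand_pos K)] with x h h'
    exact add_pos h' h

lemma eventually_bertrandDerivTwo_nonneg (K : ℕ) :
    ∀ᶠ x in atTop, 0 ≤ bertrandDerivTwo K x := by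
  induction K with
  | zero => exact Eventually.of_forall fun _ => le_rfl
  | succ K ih =>
    filter_upwards [eventually_gt_atTop 0, Real.tendsto_log_atTop.eventually ih,
      Real.tendsto_log_atTop.eventually (eventually_bertrandDeriv_pos K)] with x hx h h'
    exact div_nonneg (add_nonneg h'.le h) hx.le

lemma eventually_hasDerivAt_bertrand (K : ℕ) :
    ∀ᶠ x in atTop, HasDerivAt (bertrand K) (bertrandDeriv K x) x := by
  induction K with
  | zero => exact Eventually.of_forall fun x => hasDerivAt_id x
  | succ K ih =>
    filter_upwards [eventually_gt_atTop 0, Real.tendsto_log_atTop.eventually ih] with x hx h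
    have := (hasDerivAt_id x).mul (h.comp x (Real.hasDerivAt_log hx.ne'))
    refine this.congr_deriv ?_
    simp only [bertrandDeriv, Function.comp, id]
    field_simp

lemma eventually_hasDerivAt_bertrandDeriv (K : ℕ) :
    ∀ᶠ x in atTop, HasDerivAt (bertrandDeriv K) (bertrandDerivTwo K x) x := by
  induction K with
  | zero => exact Eventually.of_forall fun x => hasDerivAt_const x 1
  | succ K ih =>
    filter_upwards [eventually_gt_atTop 0, Real.tendsto_log_atTop.eventually ih,
      Real.tendsto_log_atTop.eventually (eventually_hasDerivAt_bertrand K)] with x hx h h'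
    have := (h'.comp x (Real.hasDerivAt_log hx.ne')).add (h.comp x (Real.hasDerivAt_log hx.ne'))
    refine this.congr_deriv ?_
    simp only [bertrandDerivTwo]
    field_simp

lemma isLittleO_comp_log {f : ℝ → ℝ} (hf : f =o[atTop] Real.exp) :
    (fun x => f (Real.log x)) =o[atTop] (fun x : ℝ => x) := by
  refine (hf.comp_tendsto Real.tendsto_log_atTop).congr' EventuallyEq.rfl ?_
  filter_upwards [eventually_gt_atTop 0] with x hx
  simp [Real.exp_log hx]

lemma bertrand_isLittleO_exp (K : ℕ) : bertrand K =o[atTop] Real.exp := by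
  induction K with
  | zero =>
    have h : bertrand 0 = fun x => x := rfl
    simpa [h] using Real.isLittleO_pow_exp_atTop (n := 1)
  | succ K ih =>
    have h := (Asymptotics.isBigO_refl (fun x : ℝ => x) atTop).mul_isLittleO
      (isLittleO_comp_log ih)
    refine h.trans ?_
    simpa [pow_two] using Real.isLittleO_pow_exp_atTop (n := 2)

lemma bertrandDeriv_isLittleO_exp (K : ℕ) : bertrandDeriv K =o[atTop] Real.exp := by
  induction K with
  | zero =>
    have h : bertrandDeriv 0 = fun _ => 1 := rfl
    simpa [h] using Real.isLittleO_pow_exp_atTop (n := 0)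
  | succ K ih =>
    have h := (isLittleO_comp_log (bertrand_isLittleO_exp K)).add (isLittleO_comp_log ih)
    refine h.trans ?_
    simpa using Real.isLittleO_pow_exp_atTop (n := 1)

/-- In the recursion the numerator is evaluated at `log x`, and a function that is `o(exp)` becomes
`o(x)` there, so the division by `x` wins. -/
lemma tendsto_bertrandDerivTwo (K : ℕ) : Tendsto (bertrandDerivTwo K) atTop (𝓝 0) := by
  induction K with
  | zero => exact tendsto_const_nhds
  | succ K ih =>
    have h1 := (isLittleO_comp_log (bertrandDeriv_isLittleO_exp K)).tendsto_div_nhds_zero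
    have h2 := (ih.comp Real.tendsto_log_atTop).div_atTop tendsto_id
    have := h1.add h2
    rw [add_zero] at this
    refine this.congr fun x => ?_
    simp [bertrandDerivTwo, add_div]

/-! ### Bertrand functions and products of iterated logarithms -/

lemma iterLog_succ (k : ℕ) (x : ℝ) : iterLog (k + 1) x = iterLog k (Real.log x) :=
  Function.iterate_succ_apply _ _ _

lemma logProd_succ (K : ℕ) (x : ℝ) :
    logProd (K + 1) x = Real.log x * logProd K (Real.log x) := by
  have h : ∀ k y, logProd k y = ∏ j ∈ Finset.range k, iterLog (j + 1) y := fun k y => by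
    rw [logProd, Finset.range_eq_Ico, Finset.prod_Ico_add' (fun j => iterLog j y) 0 k 1]
    rfl
  rw [h, h, Finset.prod_range_succ', mul_comm]
  simp [iterLog]

lemma bertrand_eq (K : ℕ) (x : ℝ) : bertrand K x = x * logProd K x := by
  induction K generalizing x with
  | zero => simp [bertrand, logProd]
  | succ K ih => rw [bertrand, ih, logProd_succ]

lemma eventually_logProd_pos (K : ℕ) : ∀ᶠ x in atTop, 0 < logProd K x := by
  filter_upwards [eventually_gt_atTop 0, eventually_bertrand_pos K] with x hx h
  rw [bertrand_eq] at h
  exact pos_of_mul_pos_right h hx.le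

lemma sum_Icc_one_div_logProd (K : ℕ) (x : ℝ) :
    1 + ∑ k ∈ Finset.Icc 1 K, 1 / logProd k x = ∑ k ∈ Finset.range (K + 1), 1 / logProd k x := by
  rw [Finset.sum_range_succ', Finset.range_eq_Ico,
    Finset.sum_Ico_add' (fun k => 1 / logProd k x) 0 K 1, add_comm]
  simp [logProd]
  rfl

lemma eventually_bertrandDeriv_eq (K : ℕ) : ∀ᶠ x in atTop,
    bertrandDeriv K x = logProd K x * (1 + ∑ k ∈ Finset.Icc 1 K, 1 / logProd k x) := by
  -- The leading `1` is the term `k = 0`, with an empty product; in this form the sum is compatible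
  -- with the recursion through `log`.
  simp only [sum_Icc_one_div_logProd]
  induction K with
  | zero => exact Eventually.of_forall fun x => by simp [bertrandDeriv, logProd]
  | succ K ih =>
    filter_upwards [eventually_gt_atTop 1, Real.tendsto_log_atTop.eventually ih] with x hx h
    have hl : 0 < Real.log x := Real.log_pos hx
    rw [bertrandDeriv, h, Finset.sum_range_succ' _ (K + 1), bertrand_eq, logProd_succ]
    simp only [logProd_succ _ x]
    have : ∑ k ∈ Finset.range (K + 1), 1 / (Real.log x * logProd k (Real.log x))
        = (1 / Real.log x) * ∑ k ∈ Finset.range (K + 1), 1 / logProd k (Real.log x) := by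
      rw [Finset.mul_sum]
      refine Finset.sum_congr rfl fun k _ => ?_
      rw [one_div_mul_one_div]
    rw [this]
    simp [logProd]
    field_simp
    ring

lemma eventually_hasDerivAt_iterLog (K : ℕ) :
    ∀ᶠ x in atTop, HasDerivAt (iterLog (K + 1)) (1 / bertrand K x) x := by
  induction K with
  | zero =>
    filter_upwards [eventually_gt_atTop 0] with x hx
    have e : iterLog (0 + 1) = Real.log := rfl
    rw [e, bertrand, one_div]
    exact Real.hasDerivAt_log hx.ne'
  | succ K ih =>
    filter_upwards [eventually_gt_atTop 0, Real.tendsto_log_atTop.eventually ih] with x hx h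
    have := h.comp x (Real.hasDerivAt_log hx.ne')
    have e : iterLog (K + 1) ∘ Real.log = iterLog (K + 1 + 1) := by
      funext y; exact (iterLog_succ _ _).symm
    rw [e] at this
    refine this.congr_deriv ?_
    rw [bertrand, one_div, one_div, mul_inv, mul_comm]

lemma tendsto_iterLog (K : ℕ) : Tendsto (iterLog K) atTop atTop := by
  induction K with
  | zero => exact tendsto_id
  | succ K ih => exact (ih.comp Real.tendsto_log_atTop).congr fun x => (iterLog_succ K x).symm

/-! ### Kummer's test -/

/-- A form of the mean value theorem on unit intervals far out. -/
lemma eventually_exists_deriv_eq {f f' : ℝ → ℝ} (h : ∀ᶠ x in atTop, HasDerivAt f (f' x) x) :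
    ∀ᶠ x in atTop, ∃ y, x < y ∧ y < x + 1 ∧ f (x + 1) - f x = f' y := by
  obtain ⟨a, ha⟩ := eventually_atTop.1 h
  filter_upwards [eventually_ge_atTop a] with x hx
  obtain ⟨y, hy, hy'⟩ := exists_hasDerivAt_eq_slope f f' (lt_add_one x)
    (fun z hz => (ha z (hx.trans hz.1)).continuousAt.continuousWithinAt)
    (fun z hz => ha z (hx.trans hz.1.le))
  exact ⟨y, hy.1, hy.2, by rw [hy']; simp⟩

/-- Kummer's test with the Bertrand functions, convergence. -/
theorem summable_of_bertrand_ratio {r q : ℕ → ℝ} {c : ℝ} (hc : 1 < c) (K : ℕ)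
    (hr : ∀ n, 0 < r n) (hq : ∀ n, r n = r (n + 1) * q (n + 1))
    (h : ∀ᶠ n : ℕ in atTop, 1 + bertrandDeriv K n / bertrand K n + (c - 1) / bertrand K n ≤ q n) :
    Summable r := by
  -- Half of the gap `c - 1` absorbs the second-order error in `B (x + 1)`; the other half remains
  -- as the gain in Kummer's inequality.
  set δ := (c - 1) / 2 with hδ
  have hδ0 : 0 < δ := by simp only [hδ]; linarith
  have hstep : ∀ᶠ x : ℝ in atTop,
      bertrand K (x + 1) + δ ≤ bertrand K x + bertrandDeriv K x + (c - 1) := by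
    have hsmall : ∀ᶠ x in atTop, bertrandDerivTwo K x < δ :=
      (tendsto_bertrandDerivTwo K).eventually_lt_const hδ0
    obtain ⟨b, hb⟩ := eventually_atTop.1 hsmall
    obtain ⟨d, hd⟩ := eventually_atTop.1 (eventually_hasDerivAt_bertrandDeriv K)
    obtain ⟨e, he⟩ := eventually_atTop.1 (eventually_bertrandDerivTwo_nonneg K)
    filter_upwards [eventually_exists_deriv_eq (eventually_hasDerivAt_bertrand K),
      eventually_ge_atTop b, eventually_ge_atTop d,
      eventually_ge_atTop e] with x ⟨y, hxy, hy, hy'⟩ hxb hxd hxe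
    obtain ⟨z, ⟨hz, hz'⟩, hz''⟩ := exists_hasDerivAt_eq_slope (bertrandDeriv K) (bertrandDerivTwo K)
      hxy (fun z hz => (hd z (hxd.trans hz.1)).continuousAt.continuousWithinAt)
      (fun z hz => hd z (hxd.trans hz.1.le))
    have h1 := hb z (hxb.trans hz.le)
    have h0 := he z (hxe.trans hz.le)
    rw [eq_div_iff (by linarith)] at hz''
    nlinarith
  -- `r n` is paired with `B (n + 1)` because the ratio `r n / r (n + 1)` is `q (n + 1)`. The
  -- inequality then telescopes to a bound on the partial sums.
  have hev : ∀ᶠ n : ℕ in atTop, r (n + 1) * bertrand K ((n : ℝ) + 1 + 1) + δ * r (n + 1)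
      ≤ r n * bertrand K ((n : ℝ) + 1) := by
    have hcast : Tendsto (fun n : ℕ => (n : ℝ) + 1) atTop atTop :=
      tendsto_atTop_add_const_right _ _ tendsto_natCast_atTop_atTop
    filter_upwards [hcast.eventually hstep, hcast.eventually (eventually_bertrand_pos K),
      (tendsto_add_atTop_nat 1).eventually h] with n h1 h2 h3
    push_cast at h3
    rw [hq n]
    have h4 : bertrand K ((n : ℝ) + 1) + bertrandDeriv K ((n : ℝ) + 1) + (c - 1)
        ≤ q (n + 1) * bertrand K ((n : ℝ) + 1) := by
      calc _ = (1 + bertrandDeriv K ((n : ℝ) + 1) / bertrand K ((n : ℝ) + 1)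
            + (c - 1) / bertrand K ((n : ℝ) + 1)) * bertrand K ((n : ℝ) + 1) := by field_simp
        _ ≤ _ := mul_le_mul_of_nonneg_right h3 h2.le
    nlinarith [mul_le_mul_of_nonneg_left (h1.trans h4) (hr (n + 1)).le]
  have hpos : ∀ᶠ n : ℕ in atTop, 0 < bertrand K ((n : ℝ) + 1) :=
    (tendsto_atTop_add_const_right _ _ tendsto_natCast_atTop_atTop).eventually
      (eventually_bertrand_pos K)
  obtain ⟨N, hN⟩ := eventually_atTop.1 (hev.and hpos)
  have hsum : ∀ m, δ * ∑ k ∈ Finset.range m, r (k + (N + 1))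
      ≤ r N * bertrand K ((N : ℝ) + 1) - r (m + N) * bertrand K (((m + N : ℕ) : ℝ) + 1) := by
    intro m
    induction m with
    | zero => simp
    | succ m ih =>
      have := (hN (m + N) (by omega)).1
      rw [Finset.sum_range_succ, mul_add, show m + 1 + N = m + N + 1 by ring,
        show m + (N + 1) = m + N + 1 by ring]
      push_cast at this ih ⊢
      linarith
  rw [← summable_nat_add_iff (N + 1)]
  refine summable_of_sum_range_le (c := r N * bertrand K ((N : ℝ) + 1) / δ)
    (fun n => (hr _).le) fun m => ?_
  rw [le_div_iff₀ hδ0, mul_comm]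
  have := mul_pos (hr (m + N)) (hN (m + N) (by omega)).2
  linarith [hsum m]

/-- Kummer's test with the Bertrand functions, divergence. -/
theorem not_summable_of_bertrand_ratio {r q : ℕ → ℝ} (K : ℕ)
    (hr : ∀ n, 0 < r n) (hq : ∀ n, r n = r (n + 1) * q (n + 1))
    (h : ∀ᶠ n : ℕ in atTop, q n ≤ 1 + bertrandDeriv K n / bertrand K n) :
    ¬ Summable r := by
  have hcast : Tendsto (fun n : ℕ => (n : ℝ) + 1) atTop atTop :=
    tendsto_atTop_add_const_right _ _ tendsto_natCast_atTop_atTop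
  have hstep : ∀ᶠ x : ℝ in atTop, bertrand K x + bertrandDeriv K x ≤ bertrand K (x + 1) := by
    obtain ⟨d, hd⟩ := eventually_atTop.1 (eventually_hasDerivAt_bertrandDeriv K)
    obtain ⟨e, he⟩ := eventually_atTop.1 (eventually_bertrandDerivTwo_nonneg K)
    filter_upwards [eventually_exists_deriv_eq (eventually_hasDerivAt_bertrand K),
      eventually_ge_atTop d, eventually_ge_atTop e] with x ⟨y, hxy, hy, hy'⟩ hxd hxe
    obtain ⟨z, ⟨hz, hz'⟩, hz''⟩ := exists_hasDerivAt_eq_slope (bertrandDeriv K) (bertrandDerivTwo K)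
      hxy (fun z hz => (hd z (hxd.trans hz.1)).continuousAt.continuousWithinAt)
      (fun z hz => hd z (hxd.trans hz.1.le))
    have h0 := he z (hxe.trans hz.le)
    rw [eq_div_iff (by linarith)] at hz''
    nlinarith
  -- `1 / B` is the derivative of `log^[K + 1]` and is eventually decreasing. Its sums thus dominate
  -- increments of a function tending to infinity.
  have hlog : ∀ᶠ x : ℝ in atTop,
      iterLog (K + 1) (x + 1) - iterLog (K + 1) x ≤ 1 / bertrand K x := by
    obtain ⟨d, hd⟩ := eventually_atTop.1 (eventually_hasDerivAt_bertrand K)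
    obtain ⟨e, he⟩ := eventually_atTop.1 (eventually_bertrandDeriv_pos K)
    filter_upwards [eventually_exists_deriv_eq (eventually_hasDerivAt_iterLog K),
      eventually_ge_atTop d, eventually_ge_atTop e, eventually_bertrand_pos K]
      with x ⟨y, hxy, hy, hy'⟩ hxd hxe hpos
    obtain ⟨z, ⟨hz, hz'⟩, hz''⟩ := exists_hasDerivAt_eq_slope (bertrand K) (bertrandDeriv K)
      hxy (fun z hz => (hd z (hxd.trans hz.1)).continuousAt.continuousWithinAt)
      (fun z hz => hd z (hxd.trans hz.1.le))
    have h0 := he z (hxe.trans hz.le)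
    rw [eq_div_iff (by linarith)] at hz''
    rw [hy']
    exact one_div_le_one_div_of_le hpos (by nlinarith)
  -- So `r n * B (n + 1)` is eventually nondecreasing, and `r n` is at least a constant multiple of
  -- `1 / B (n + 1)`.
  have hev : ∀ᶠ n : ℕ in atTop, r n * bertrand K ((n : ℝ) + 1)
      ≤ r (n + 1) * bertrand K ((n : ℝ) + 1 + 1) := by
    filter_upwards [hcast.eventually hstep, hcast.eventually (eventually_bertrand_pos K),
      (tendsto_add_atTop_nat 1).eventually h] with n h1 h2 h3
    push_cast at h3
    rw [hq n, mul_assoc]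
    refine mul_le_mul_of_nonneg_left ?_ (hr _).le
    calc _ ≤ (1 + bertrandDeriv K ((n : ℝ) + 1) / bertrand K ((n : ℝ) + 1))
          * bertrand K ((n : ℝ) + 1) := mul_le_mul_of_nonneg_right h3 h2.le
      _ = bertrand K ((n : ℝ) + 1) + bertrandDeriv K ((n : ℝ) + 1) := by field_simp
      _ ≤ _ := h1
  obtain ⟨N, hN⟩ := eventually_atTop.1
    ((hev.and (hcast.eventually (eventually_bertrand_pos K))).and (hcast.eventually hlog))
  set C := r N * bertrand K ((N : ℝ) + 1) with hC
  have hC0 : 0 < C := mul_pos (hr N) (hN N le_rfl).1.2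
  have hlow : ∀ n, N ≤ n → C ≤ r n * bertrand K ((n : ℝ) + 1) := by
    intro n hn
    induction n, hn using Nat.le_induction with
    | base => exact le_rfl
    | succ n hn ih => exact_mod_cast ih.trans (by exact_mod_cast (hN n hn).1.1)
  intro hs
  have hbd : ∀ m, C * (iterLog (K + 1) (((m + N : ℕ) : ℝ) + 1) - iterLog (K + 1) ((N : ℝ) + 1))
      ≤ ∑ k ∈ Finset.range m, r (k + N) := by
    intro m
    induction m with
    | zero => simp
    | succ m ih =>
      have h1 := hN (m + N) (by omega)
      have h2 := hlow (m + N) (by omega)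
      have h3 : C * (1 / bertrand K (((m + N : ℕ) : ℝ) + 1)) ≤ r (m + N) := by
        rw [mul_one_div]
        exact (div_le_iff₀ h1.1.2).2 h2
      have h4 := mul_le_mul_of_nonneg_left h1.2 hC0.le
      rw [Finset.sum_range_succ, show m + 1 + N = m + N + 1 by ring]
      push_cast at h3 h4 ih ⊢
      linarith
  have hs' := (summable_nat_add_iff N).2 hs
  have htend : Tendsto (fun m : ℕ =>
      C * (iterLog (K + 1) (((m + N : ℕ) : ℝ) + 1) - iterLog (K + 1) ((N : ℝ) + 1)))
      atTop atTop := by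
    refine Tendsto.const_mul_atTop hC0 (tendsto_atTop_add_const_right _ _ ?_)
    exact (tendsto_iterLog (K + 1)).comp (hcast.comp (tendsto_add_atTop_nat N))
  obtain ⟨m, hm⟩ := (htend.eventually_gt_atTop (∑' k, r (k + N))).exists
  have := hs'.sum_le_tsum (Finset.range m) fun k _ => (hr _).le
  linarith [hbd m]

/-! ### The scale density under the two hypotheses -/

/-- The reciprocal of the product of the ratios `lam k / mu k`, `1 ≤ k ≤ n`. -/
def scaleDensity (lam mu : ℕ → ℝ) (n : ℕ) : ℝ :=
  ∏ k ∈ Finset.range n, mu (k + 1) / lam (k + 1)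

variable {lam mu : ℕ → ℝ}

lemma scaleDensity_pos (hlam : ∀ n, 0 < lam n) (hmu : ∀ n, 1 ≤ n → 0 < mu n) (n : ℕ) :
    0 < scaleDensity lam mu n :=
  Finset.prod_pos fun k _ => div_pos (hmu _ (by omega)) (hlam _)

lemma scaleDensity_succ (n : ℕ) :
    scaleDensity lam mu (n + 1) = scaleDensity lam mu n * (mu (n + 1) / lam (n + 1)) :=
  Finset.prod_range_succ _ _

lemma scaleDensity_eq (hlam : ∀ n, 0 < lam n) (hmu : ∀ n, 1 ≤ n → 0 < mu n) (n : ℕ) :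
    scaleDensity lam mu n = scaleDensity lam mu (n + 1) * (lam (n + 1) / mu (n + 1)) := by
  have h1 := hlam (n + 1)
  have h2 := hmu (n + 1) (by omega)
  rw [scaleDensity_succ]
  field_simp

lemma eventually_bertrandDeriv_div (K : ℕ) : ∀ᶠ x in atTop, bertrandDeriv K x / bertrand K x =
    1 / x + 1 / x * ∑ k ∈ Finset.Icc 1 K, 1 / logProd k x := by
  filter_upwards [eventually_bertrandDeriv_eq K, eventually_logProd_pos K, eventually_gt_atTop 0]
    with x h h1 h2
  rw [h, bertrand_eq]
  field_simp

lemma summable_scaleDensity (hlam : ∀ n, 0 < lam n) (hmu : ∀ n, 1 ≤ n → 0 < mu n)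
    {c : ℝ} (hc : 1 < c) {K : ℕ} (hK : 1 ≤ K) {n₀ : ℕ}
    (h : ∀ n : ℕ, n₀ < n → 1 + 1 / (n : ℝ)
          + 1 / (n : ℝ) * ∑ k ∈ Finset.Icc 1 (K - 1), 1 / logProd k (n : ℝ)
          + c / ((n : ℝ) * logProd K (n : ℝ)) ≤ lam n / mu n) :
    Summable (scaleDensity lam mu) := by
  refine summable_of_bertrand_ratio (q := fun n => lam n / mu n) hc K (scaleDensity_pos hlam hmu)
    (scaleDensity_eq hlam hmu) ?_
  filter_upwards [eventually_gt_atTop n₀,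
    tendsto_natCast_atTop_atTop.eventually (eventually_bertrandDeriv_div K),
    tendsto_natCast_atTop_atTop.eventually (eventually_logProd_pos K)] with n hn h1 h2
  refine le_trans (le_of_eq ?_) (h n hn)
  -- The last term splits as `c = 1 + (c - 1)`: the `1` completes the sum for `B'/B`, the rest is
  -- the excess `(c - 1)/B`.
  obtain ⟨K, rfl⟩ : ∃ k, K = k + 1 := ⟨K - 1, by omega⟩
  rw [h1, Finset.sum_Icc_succ_top (by omega), bertrand_eq, Nat.add_sub_cancel]
  have : (0 : ℝ) < n := by exact_mod_cast (by omega : 0 < n)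
  field_simp
  ring

lemma not_summable_scaleDensity (hlam : ∀ n, 0 < lam n) (hmu : ∀ n, 1 ≤ n → 0 < mu n)
    {K n₀ : ℕ} (h : ∀ n : ℕ, n₀ < n → lam n / mu n ≤ 1 + 1 / (n : ℝ)
          + 1 / (n : ℝ) * ∑ k ∈ Finset.Icc 1 K, 1 / logProd k (n : ℝ)) :
    ¬ Summable (scaleDensity lam mu) := by
  refine not_summable_of_bertrand_ratio (q := fun n => lam n / mu n) K (scaleDensity_pos hlam hmu)
    (scaleDensity_eq hlam hmu) ?_
  filter_upwards [eventually_gt_atTop n₀,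
    tendsto_natCast_atTop_atTop.eventually (eventually_bertrandDeriv_div K)] with n hn h1
  rw [h1, ← add_assoc]
  exact h n hn

/-! ### The transition operator of the jump chain -/

/-- One step of the embedded jump chain, acting on functions. -/
def average (lam mu : ℕ → ℝ) (g : ℕ → ℝ) (z : ℕ) : ℝ :=
  jumpProb lam mu z (z + 1) * g (z + 1) + jumpProb lam mu z (z - 1) * g (z - 1)

lemma exitRate_pos (hlam : ∀ n, 0 < lam n) (hmu : ∀ n, 1 ≤ n → 0 < mu n) (z : ℕ) :
    0 < exitRate lam mu z := by
  rw [exitRate]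
  split_ifs with h
  · simpa using hlam z
  · exact add_pos (hlam z) (hmu z (by omega))

lemma jumpProb_succ (z : ℕ) : jumpProb lam mu z (z + 1) = lam z / exitRate lam mu z := by
  simp [jumpProb, rate]

/-- Truncated subtraction turns the death from `0` into a jump `0 → 0` of probability `0`, so
`average` needs no case distinction. -/
lemma jumpProb_pred (z : ℕ) :
    jumpProb lam mu z (z - 1) = (if z = 0 then 0 else mu z) / exitRate lam mu z := by
  rcases z with _ | z
  · simp [jumpProb, rate]
  · have : z ≠ z + 1 + 1 := by omega
    simp [jumpProb, rate, this]

lemma jumpProb_eq_zero {z j : ℕ} (h1 : j ≠ z + 1) (h2 : j ≠ z - 1) : jumpProb lam mu z j = 0 := by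
  have : z ≠ j + 1 := by omega
  simp [jumpProb, rate, h1, this]

lemma jumpProb_nonneg (hlam : ∀ n, 0 < lam n) (hmu : ∀ n, 1 ≤ n → 0 < mu n) (z j : ℕ) :
    0 ≤ jumpProb lam mu z j := by
  refine div_nonneg ?_ (exitRate_pos hlam hmu z).le
  rw [rate]
  split_ifs with h1 h2
  · exact (hlam z).le
  · exact (hmu z (by omega)).le
  · exact le_rfl

lemma jumpProb_succ_pos (hlam : ∀ n, 0 < lam n) (hmu : ∀ n, 1 ≤ n → 0 < mu n) (z : ℕ) :
    0 < jumpProb lam mu z (z + 1) := by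
  rw [jumpProb_succ]
  exact div_pos (hlam z) (exitRate_pos hlam hmu z)

lemma jumpProb_zero_zero : jumpProb lam mu 0 0 = 0 := by
  simp [jumpProb, rate]

lemma jumpProb_add (hlam : ∀ n, 0 < lam n) (hmu : ∀ n, 1 ≤ n → 0 < mu n) (z : ℕ) :
    jumpProb lam mu z (z + 1) + jumpProb lam mu z (z - 1) = 1 := by
  have := exitRate_pos hlam hmu z
  rw [jumpProb_succ, jumpProb_pred, ← add_div]
  exact div_self this.ne'

/-- The scale density makes the scale function harmonic for the jump chain. -/
lemma jumpProb_mul_scaleDensity (hlam : ∀ n, 0 < lam n) (z : ℕ) :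
    jumpProb lam mu (z + 1) (z + 1 + 1) * scaleDensity lam mu (z + 1)
      = jumpProb lam mu (z + 1) z * scaleDensity lam mu z := by
  have h := jumpProb_pred (lam := lam) (mu := mu) (z + 1)
  simp only [Nat.add_sub_cancel, Nat.succ_ne_zero, if_false] at h
  rw [jumpProb_succ, h, scaleDensity_succ]
  have := hlam (z + 1)
  field_simp

lemma average_nonneg (hlam : ∀ n, 0 < lam n) (hmu : ∀ n, 1 ≤ n → 0 < mu n) {g : ℕ → ℝ}
    (hg : ∀ z, 0 ≤ g z) (z : ℕ) : 0 ≤ average lam mu g z :=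
  add_nonneg (mul_nonneg (jumpProb_nonneg hlam hmu _ _) (hg _))
    (mul_nonneg (jumpProb_nonneg hlam hmu _ _) (hg _))

lemma average_mono (hlam : ∀ n, 0 < lam n) (hmu : ∀ n, 1 ≤ n → 0 < mu n) {g h : ℕ → ℝ}
    (hgh : ∀ z, g z ≤ h z) (z : ℕ) : average lam mu g z ≤ average lam mu h z :=
  add_le_add (mul_le_mul_of_nonneg_left (hgh _) (jumpProb_nonneg hlam hmu _ _))
    (mul_le_mul_of_nonneg_left (hgh _) (jumpProb_nonneg hlam hmu _ _))

lemma average_one (hlam : ∀ n, 0 < lam n) (hmu : ∀ n, 1 ≤ n → 0 < mu n) (z : ℕ) :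
    average lam mu (fun _ => 1) z = 1 := by
  simp [average, jumpProb_add hlam hmu z]

lemma tsum_jumpProb_mul (hlam : ∀ n, 0 < lam n) (hmu : ∀ n, 1 ≤ n → 0 < mu n) {g : ℕ → ℝ}
    (hg : ∀ z, 0 ≤ g z) (z : ℕ) :
    ∑' j, ENNReal.ofReal (jumpProb lam mu z j * g j) = ENNReal.ofReal (average lam mu g z) := by
  rw [tsum_eq_sum (s := {z + 1, z - 1}), Finset.sum_pair (by omega), average, ENNReal.ofReal_add]
  · exact mul_nonneg (jumpProb_nonneg hlam hmu _ _) (hg _)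
  · exact mul_nonneg (jumpProb_nonneg hlam hmu _ _) (hg _)
  · intro j hj
    simp only [Finset.mem_insert, Finset.mem_singleton, not_or] at hj
    simp [jumpProb_eq_zero hj.1 hj.2]

/-! ### Marked paths of the jump chain -/

section PathLaw

variable {Ω : Type*} [MeasurableSpace Ω] {P : Measure Ω} {Y : ℕ → Ω → ℕ}

lemma measure_eq_tsum_fiber {Z : Ω → ℕ} (hZ : Measurable Z) {A : Set Ω} (hA : MeasurableSet A) :
    P A = ∑' z, P (A ∩ {ω | Z ω = z}) := by
  have hm : ∀ z, MeasurableSet {ω | Z ω = z} := fun z => hZ (measurableSet_singleton z)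
  rw [← measure_iUnion (fun a b hab => ?_) fun z => hA.inter (hm z)]
  · congr 1
    ext ω
    simp
  · refine Set.disjoint_left.2 fun ω h1 h2 => hab ?_
    exact h1.2.symm.trans h2.2

/-- Events `E k` attached to the steps of the jump chain `Y` started at `i`, with conditional
probability `w k z` given that the chain is in `z` at time `k`. -/
structure IsMarking (lam mu : ℕ → ℝ) (i : ℕ) (P : Measure Ω) (Y : ℕ → Ω → ℕ) (E : ℕ → Set Ω)
    (w : ℕ → ℕ → ℝ) : Prop where
  measurable_chain : ∀ n, Measurable (Y n)
  measurableSet : ∀ n, MeasurableSet (E n)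
  nonneg : ∀ n z, 0 ≤ w n z
  law : ∀ (n : ℕ) (y : ℕ → ℕ), P {ω | ∀ k ≤ n, Y k ω = y k ∧ ω ∈ E k} =
    if y 0 = i then ENNReal.ofReal ((∏ k ∈ Finset.range n, jumpProb lam mu (y k) (y (k + 1))) *
      ∏ k ∈ Finset.range (n + 1), w k (y k)) else 0

namespace IsMarking

variable {i : ℕ} {E : ℕ → Set Ω} {w : ℕ → ℕ → ℝ}

lemma measurableSet_forall (hE : IsMarking lam mu i P Y E w) (n : ℕ) :
    MeasurableSet {ω | ∀ k ≤ n, ω ∈ E k} := by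
  simp only [Set.ofPred_forall]
  exact MeasurableSet.iInter fun k => MeasurableSet.iInter fun _ => hE.measurableSet k

/-- The Markov property in weighted form. With the whole path prescribed it is the product formula;
the early coordinates are then released one at a time by summing over their values, since the last
factor does not involve them. -/
lemma measure_tail (hlam : ∀ n, 0 < lam n) (hmu : ∀ n, 1 ≤ n → 0 < mu n)
    (hE : IsMarking lam mu i P Y E w) {n j : ℕ} (hj : j ≤ n) (y : ℕ → ℕ) :
    P {ω | (∀ k ≤ n + 1, ω ∈ E k) ∧ ∀ k, j ≤ k → k ≤ n + 1 → Y k ω = y k} =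
      P {ω | (∀ k ≤ n, ω ∈ E k) ∧ ∀ k, j ≤ k → k ≤ n → Y k ω = y k} *
        ENNReal.ofReal (jumpProb lam mu (y n) (y (n + 1)) * w (n + 1) (y (n + 1))) := by
  have hmeas : ∀ (N j : ℕ) (y : ℕ → ℕ), MeasurableSet
      {ω | (∀ k ≤ N, ω ∈ E k) ∧ ∀ k, j ≤ k → k ≤ N → Y k ω = y k} := fun N j y => by
    refine (hE.measurableSet_forall N).inter
      (show MeasurableSet {ω | ∀ k, j ≤ k → k ≤ N → Y k ω = y k} from ?_)
    simp only [Set.ofPred_forall]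
    exact MeasurableSet.iInter fun k => MeasurableSet.iInter fun _ => MeasurableSet.iInter fun _ =>
      hE.measurable_chain k (measurableSet_singleton _)
  induction j generalizing y with
  | zero =>
    have hset : ∀ N, {ω | (∀ k ≤ N, ω ∈ E k) ∧ ∀ k, 0 ≤ k → k ≤ N → Y k ω = y k}
        = {ω | ∀ k ≤ N, Y k ω = y k ∧ ω ∈ E k} := fun N => by
      ext ω
      simp only [Set.mem_ofPred_eq, zero_le, true_implies]
      exact ⟨fun h k hk => ⟨h.2 k hk, h.1 k hk⟩, fun h => ⟨fun k hk => (h k hk).2,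
        fun k hk => (h k hk).1⟩⟩
    rw [hset, hset, hE.law, hE.law]
    split_ifs
    · rw [← ENNReal.ofReal_mul]
      · congr 1
        rw [Finset.prod_range_succ _ n, Finset.prod_range_succ _ (n + 1)]
        ring
      · exact mul_nonneg (Finset.prod_nonneg fun k _ => jumpProb_nonneg hlam hmu _ _)
          (Finset.prod_nonneg fun k _ => hE.nonneg _ _)
    · simp
  | succ j ih =>
    have hset : ∀ N z, j ≤ N →
        {ω | (∀ k ≤ N, ω ∈ E k) ∧ ∀ k, j + 1 ≤ k → k ≤ N → Y k ω = y k} ∩ {ω | Y j ω = z}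
        = {ω | (∀ k ≤ N, ω ∈ E k) ∧ ∀ k, j ≤ k → k ≤ N → Y k ω = Function.update y j z k} := by
      intro N z hN
      ext ω
      simp only [Set.mem_inter_iff, Set.mem_ofPred_eq, and_assoc]
      refine and_congr_right fun _ => ⟨fun h k hk hk' => ?_, fun h => ⟨fun k hk hk' => ?_, ?_⟩⟩
      · rcases hk.eq_or_lt with rfl | hlt
        · simpa using h.2
        · rw [Function.update_of_ne (by omega)]
          exact h.1 k hlt hk'
      · have := h k (by omega) hk'
        rwa [Function.update_of_ne (by omega)] at this
      · simpa using h j le_rfl hN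
    rw [measure_eq_tsum_fiber (hE.measurable_chain j) (hmeas (n + 1) (j + 1) y),
      measure_eq_tsum_fiber (hE.measurable_chain j) (hmeas n (j + 1) y), ← ENNReal.tsum_mul_right]
    refine tsum_congr fun z => ?_
    rw [hset (n + 1) z (by omega), hset n z (by omega), ih (by omega),
      Function.update_of_ne (by omega), Function.update_of_ne (by omega)]

/-- The part of the law of `Y n` on which all the events `E 0, …, E n` happen. -/
def stateMass (P : Measure Ω) (Y : ℕ → Ω → ℕ) (E : ℕ → Set Ω) (n z : ℕ) : ENNReal :=
  P {ω | (∀ k ≤ n, ω ∈ E k) ∧ Y n ω = z}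

lemma tsum_stateMass (hE : IsMarking lam mu i P Y E w) (n : ℕ) :
    ∑' z, stateMass P Y E n z = P {ω | ∀ k ≤ n, ω ∈ E k} :=
  (measure_eq_tsum_fiber (hE.measurable_chain n) (hE.measurableSet_forall n)).symm

lemma tsum_stateMass_zero_mul (hE : IsMarking lam mu i P Y E w) (g : ℕ → ℝ) :
    ∑' z, stateMass P Y E 0 z * ENNReal.ofReal (g z) = ENNReal.ofReal (w 0 i * g i) := by
  have h : ∀ z, stateMass P Y E 0 z = if z = i then ENNReal.ofReal (w 0 z) else 0 := fun z => by
    have := hE.law 0 fun _ => z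
    simp only [Nat.le_zero, forall_eq, zero_add, Finset.range_zero, Finset.prod_empty,
      Finset.range_one, Finset.prod_singleton, one_mul] at this
    rw [← this, stateMass]
    simp only [Nat.le_zero, forall_eq, and_comm]
  rw [tsum_eq_single i fun z hz => by simp [h, hz], h, if_pos rfl,
    ENNReal.ofReal_mul (hE.nonneg _ _)]

/-- Moving one step back in time transfers the transition operator to the test function; the weight
belongs to the state of arrival. -/
lemma tsum_stateMass_succ_mul (hlam : ∀ n, 0 < lam n) (hmu : ∀ n, 1 ≤ n → 0 < mu n)
    (hE : IsMarking lam mu i P Y E w) {g : ℕ → ℝ} (hg : ∀ z, 0 ≤ g z) (n : ℕ) :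
    ∑' z, stateMass P Y E (n + 1) z * ENNReal.ofReal (g z) =
      ∑' z, stateMass P Y E n z *
        ENNReal.ofReal (average lam mu (fun z => w (n + 1) z * g z) z) := by
  have hstep : ∀ z', stateMass P Y E (n + 1) z' =
      ∑' z, stateMass P Y E n z * ENNReal.ofReal (jumpProb lam mu z z' * w (n + 1) z') := by
    intro z'
    have hm : MeasurableSet {ω | (∀ k ≤ n + 1, ω ∈ E k) ∧ Y (n + 1) ω = z'} :=
      (hE.measurableSet_forall (n + 1)).inter
        (hE.measurable_chain (n + 1) (measurableSet_singleton z'))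
    rw [stateMass, measure_eq_tsum_fiber (hE.measurable_chain n) hm]
    refine tsum_congr fun z => ?_
    have h := hE.measure_tail hlam hmu (le_refl n) (Function.update (fun _ => z') n z)
    rw [Function.update_self, Function.update_of_ne (by omega)] at h
    rw [stateMass]
    convert h using 2
    · ext ω
      simp only [Set.mem_inter_iff, Set.mem_ofPred_eq, and_assoc]
      refine and_congr_right fun _ => ⟨fun h k hk hk' => ?_, fun h => ⟨?_, ?_⟩⟩
      · rcases hk.eq_or_lt with rfl | hlt
        · simpa using h.2
        · obtain rfl : k = n + 1 := by omega
          rw [Function.update_of_ne (by omega)]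
          exact h.1
      · have := h (n + 1) (by omega) le_rfl
        rwa [Function.update_of_ne (by omega)] at this
      · simpa using h n le_rfl (by omega)
    · congr 1
      ext ω
      simp only [Set.mem_ofPred_eq]
      refine and_congr_right fun _ => ⟨fun h k hk hk' => ?_, fun h => ?_⟩
      · obtain rfl : k = n := by omega
        simpa using h
      · simpa using h n le_rfl le_rfl
  calc ∑' z', stateMass P Y E (n + 1) z' * ENNReal.ofReal (g z')
      = ∑' z', ∑' z, stateMass P Y E n z *
          ENNReal.ofReal (jumpProb lam mu z z' * (w (n + 1) z' * g z')) := by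
        refine tsum_congr fun z' => ?_
        rw [hstep, ← ENNReal.tsum_mul_right]
        refine tsum_congr fun z => ?_
        rw [mul_assoc, ← ENNReal.ofReal_mul
          (mul_nonneg (jumpProb_nonneg hlam hmu _ _) (hE.nonneg _ _)), mul_assoc]
    _ = _ := by
        rw [ENNReal.tsum_comm]
        refine tsum_congr fun z => ?_
        rw [ENNReal.tsum_mul_left,
          tsum_jumpProb_mul hlam hmu fun z => mul_nonneg (hE.nonneg _ _) (hg z)]

end IsMarking

/-! ### Capped holding times -/

namespace IsJumpData

variable {i : ℕ} {S : ℕ → Ω → ℝ}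

/-- `IsJumpData` only gives lower bounds on holding times. A cap at index `d` is the difference of
two such events, the second having `t d` raised to `1`; hence the induction over `D` for all `t`. -/
lemma law_capped [IsProbabilityMeasure P] (hlam : ∀ n, 0 < lam n)
    (hmu : ∀ n, 1 ≤ n → 0 < mu n) (hJ : IsJumpData lam mu i P Y S) (n : ℕ) (y : ℕ → ℕ)
    (D : Finset ℕ) (hD : ∀ k ∈ D, k ≤ n) (t : ℕ → ℝ) (ht : ∀ k, 0 ≤ t k)
    (htD : ∀ k ∈ D, t k ≤ 1) :
    P {ω | ∀ k ≤ n, Y k ω = y k ∧ t k < S k ω ∧ (k ∈ D → S k ω ≤ 1)} =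
      if y 0 = i then
        ENNReal.ofReal ((∏ k ∈ Finset.range n, jumpProb lam mu (y k) (y (k + 1))) *
          ∏ k ∈ Finset.range (n + 1), (Real.exp (-(exitRate lam mu (y k) * t k)) -
            if k ∈ D then Real.exp (-exitRate lam mu (y k)) else 0))
      else 0 := by
  induction D using Finset.induction_on generalizing t with
  | empty => simpa using hJ.law n y t ht
  | insert d D hd ih =>
    have hdn : d ≤ n := hD d (Finset.mem_insert_self _ _)
    set t' := Function.update t d 1 with ht'
    have ht'0 : ∀ k, 0 ≤ t' k := fun k => by
      rcases eq_or_ne k d with rfl | h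
      · simp [ht']
      · simpa [ht', h] using ht k
    have htd : t d ≤ 1 := htD d (Finset.mem_insert_self _ _)
    have h1 := ih (fun k hk => hD k (Finset.mem_insert_of_mem hk)) t ht
      (fun k hk => htD k (Finset.mem_insert_of_mem hk))
    have h2 := ih (fun k hk => hD k (Finset.mem_insert_of_mem hk)) t' ht'0 (fun k hk => by
      rcases eq_or_ne k d with rfl | h
      · simp [ht']
      · simpa [ht', h] using htD k (Finset.mem_insert_of_mem hk))
    have hset : {ω | ∀ k ≤ n, Y k ω = y k ∧ t k < S k ω ∧ (k ∈ insert d D → S k ω ≤ 1)} =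
        {ω | ∀ k ≤ n, Y k ω = y k ∧ t k < S k ω ∧ (k ∈ D → S k ω ≤ 1)} \
        {ω | ∀ k ≤ n, Y k ω = y k ∧ t' k < S k ω ∧ (k ∈ D → S k ω ≤ 1)} := by
      ext ω
      simp only [Set.mem_sdiff, Set.mem_ofPred_eq]
      constructor
      · intro h
        refine ⟨fun k hk => ⟨(h k hk).1, (h k hk).2.1,
          fun hk' => (h k hk).2.2 (Finset.mem_insert_of_mem hk')⟩, fun h' => ?_⟩
        have h3 := (h' d hdn).2.1
        simp only [ht', Function.update_self] at h3
        exact absurd ((h d hdn).2.2 (Finset.mem_insert_self _ _)) (not_le.2 h3)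
      · rintro ⟨h, h'⟩ k hk
        refine ⟨(h k hk).1, (h k hk).2.1, fun hk' => ?_⟩
        rcases Finset.mem_insert.1 hk' with rfl | hk'
        · by_contra hlt
          refine h' fun l hl => ⟨(h l hl).1, ?_, (h l hl).2.2⟩
          rcases eq_or_ne l k with rfl | hne
          · simpa [ht'] using hlt
          · simpa [ht', hne] using (h l hl).2.1
        · exact (h k hk).2.2 hk'
    have hsub : {ω | ∀ k ≤ n, Y k ω = y k ∧ t' k < S k ω ∧ (k ∈ D → S k ω ≤ 1)} ⊆
        {ω | ∀ k ≤ n, Y k ω = y k ∧ t k < S k ω ∧ (k ∈ D → S k ω ≤ 1)} := by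
      intro ω h k hk
      refine ⟨(h k hk).1, ?_, (h k hk).2.2⟩
      refine lt_of_le_of_lt ?_ (h k hk).2.1
      rcases eq_or_ne k d with rfl | h
      · simpa [ht'] using htd
      · simp [ht', h]
    have hmeas : MeasurableSet
        {ω | ∀ k ≤ n, Y k ω = y k ∧ t' k < S k ω ∧ (k ∈ D → S k ω ≤ 1)} := by
      simp only [Set.ofPred_forall, Set.ofPred_and]
      exact MeasurableSet.iInter fun k => MeasurableSet.iInter fun _ =>
        (hJ.measurable_chain k (measurableSet_singleton _)).inter
          ((measurableSet_lt measurable_const (hJ.measurable_holding k)).inter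
            (MeasurableSet.iInter fun _ =>
              measurableSet_le (hJ.measurable_holding k) measurable_const))
    rw [hset, measure_sdiff hsub hmeas.nullMeasurableSet (measure_ne_top _ _), h1, h2]
    split_ifs with h0
    · rw [← ENNReal.ofReal_sub]
      · congr 1
        rw [← mul_sub]
        congr 1
        have hmem : d ∈ Finset.range (n + 1) := Finset.mem_range.2 (by omega)
        rw [← Finset.mul_prod_erase _ _ hmem, ← Finset.mul_prod_erase _ _ hmem,
          ← Finset.mul_prod_erase _ _ hmem]
        have e1 : ∏ k ∈ (Finset.range (n + 1)).erase d,
              (Real.exp (-(exitRate lam mu (y k) * t' k)) -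
                if k ∈ D then Real.exp (-exitRate lam mu (y k)) else 0) =
            ∏ k ∈ (Finset.range (n + 1)).erase d,
              (Real.exp (-(exitRate lam mu (y k) * t k)) -
                if k ∈ D then Real.exp (-exitRate lam mu (y k)) else 0) :=
          Finset.prod_congr rfl fun k hk => by
            rw [ht', Function.update_of_ne (Finset.ne_of_mem_erase hk)]
        have e2 : ∏ k ∈ (Finset.range (n + 1)).erase d,
              (Real.exp (-(exitRate lam mu (y k) * t k)) -
                if k ∈ insert d D then Real.exp (-exitRate lam mu (y k)) else 0) =
            ∏ k ∈ (Finset.range (n + 1)).erase d,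
              (Real.exp (-(exitRate lam mu (y k) * t k)) -
                if k ∈ D then Real.exp (-exitRate lam mu (y k)) else 0) :=
          Finset.prod_congr rfl fun k hk => by
            simp [Finset.mem_insert, Finset.ne_of_mem_erase hk]
        rw [e1, e2]
        simp only [ht', Function.update_self, hd, if_false, Finset.mem_insert_self, if_true]
        ring_nf
      · refine mul_nonneg (Finset.prod_nonneg fun k _ => jumpProb_nonneg hlam hmu _ _)
          (Finset.prod_nonneg fun k _ => ?_)
        have hq := exitRate_pos hlam hmu (y k)
        split_ifs with hk
        · rw [sub_nonneg, Real.exp_le_exp, neg_le_neg_iff]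
          have : t' k ≤ 1 := by
            rcases eq_or_ne k d with rfl | h
            · simp [ht']
            · simpa [ht', h] using htD k (Finset.mem_insert_of_mem hk)
          nlinarith
        · simpa using (Real.exp_pos _).le
    · simp

/-- The probability that a holding time in the state `z` survives the cap `1` imposed on the
visits to `i`. -/
def capWeight (lam mu : ℕ → ℝ) (i z : ℕ) : ℝ :=
  if z = i then 1 - Real.exp (-exitRate lam mu i) else 1

open Classical in
/-- Positivity of the holding times, together with the cap `1` on the holding times of the visits to
`i` at the times in `M`, is a marking of the jump chain. -/
lemma isMarking [IsProbabilityMeasure P] (hlam : ∀ n, 0 < lam n)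
    (hmu : ∀ n, 1 ≤ n → 0 < mu n) (hJ : IsJumpData lam mu i P Y S) (M : Set ℕ) :
    IsMarking lam mu i P Y (fun k => {ω | 0 < S k ω ∧ (k ∈ M → Y k ω = i → S k ω ≤ 1)})
      (fun k z => if k ∈ M then capWeight lam mu i z else 1) where
  measurable_chain := hJ.measurable_chain
  measurableSet n := by
    simp only [Set.ofPred_and]
    refine (measurableSet_lt measurable_const (hJ.measurable_holding n)).inter ?_
    refine (MeasurableSet.const _).imp ?_
    exact MeasurableSet.imp (hJ.measurable_chain n (measurableSet_singleton i))
      (measurableSet_le (hJ.measurable_holding n) measurable_const)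
  nonneg n z := by
    have := exitRate_pos hlam hmu i
    simp only [capWeight]
    split_ifs
    · rw [sub_nonneg, Real.exp_le_one_iff]
      linarith
    · exact zero_le_one
    · exact zero_le_one
  law n y := by
    have h := hJ.law_capped hlam hmu n y ((Finset.range (n + 1)).filter fun k => k ∈ M ∧ y k = i)
      (fun k hk => by simp at hk; omega) (fun _ => 0) (fun _ => le_rfl) (fun _ _ => zero_le_one)
    convert h using 1
    · congr 1
      ext ω
      simp only [Set.mem_ofPred_eq]
      refine forall_congr' fun k => forall_congr' fun hk => and_congr_right fun hy => ?_
      have : k < n + 1 := by omega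
      simp [hy, this]
    · congr 3
      refine Finset.prod_congr rfl fun k hk => ?_
      have hk' : k ∈ Finset.range (n + 1) := hk
      by_cases h1 : k ∈ M <;> by_cases h2 : y k = i <;>
        simp [capWeight, h1, h2, Finset.mem_range.1 hk']

end IsJumpData

end PathLaw

/-! ### Harmonic functions of the killed chain and the Green function -/

/-- A bounded function that is harmonic for the jump chain killed with positive probability at its
visits to `i` vanishes, if the scale function is unbounded. -/
lemma eq_zero_of_killed_harmonic (hlam : ∀ n, 0 < lam n) (hmu : ∀ n, 1 ≤ n → 0 < mu n)
    (hr : ¬ Summable (scaleDensity lam mu)) {i : ℕ} {b : ℝ} (hb0 : 0 < b) (hb1 : b < 1)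
    {u : ℕ → ℝ} (hu0 : ∀ z, 0 ≤ u z) (hu1 : ∀ z, u z ≤ 1)
    (hui : u i = b * average lam mu u i) (hu : ∀ z, z ≠ i → u z = average lam mu u z) (z : ℕ) :
    u z = 0 := by
  have hp := jumpProb_succ_pos hlam hmu
  have hpq := jumpProb_add hlam hmu
  have hr0 := scaleDensity_pos hlam hmu
  -- From `0` the chain moves surely to `1`, so the first increment vanishes, and harmonicity
  -- carries this up to `i`.
  have hbelow : ∀ z, z < i → u (z + 1) = u z := by
    intro z
    induction z with
    | zero =>
      intro h
      have h1 := hu 0 (by omega)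
      have h2 := hpq 0
      simp only [average, zero_add, Nat.zero_sub, jumpProb_zero_zero, zero_mul, add_zero] at h1 h2
      rw [h2, one_mul] at h1
      exact h1.symm
    | succ z ih =>
      intro h
      have h1 := hu (z + 1) (by omega)
      have h2 := hpq (z + 1)
      simp only [average, Nat.add_sub_cancel] at h1 h2
      rw [← ih (by omega)] at h1
      refine mul_left_cancel₀ (hp (z + 1)).ne' ?_
      linear_combination -h1 + u (z + 1) * (-h2)
  have hpred : u (i - 1) = u i := by
    rcases i with _ | i
    · rfl
    · exact (hbelow i (by omega)).symm
  have hbelow' : ∀ z, z ≤ i → u z = u i := by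
    intro z hz
    induction hz using Nat.decreasingInduction with
    | self => rfl
    | of_succ k hk ih => rw [← hbelow k hk, ih]
  set d := u (i + 1) - u i with hd
  have hdi : b * jumpProb lam mu i (i + 1) * d = (1 - b) * u i := by
    rw [average, hpred] at hui
    rw [hd]
    linear_combination -hui - b * u i * hpq i
  -- Above `i`, harmonicity makes the increments of `u` proportional to the scale density.
  have hincr : ∀ k, u (i + k + 1) - u (i + k)
      = d / scaleDensity lam mu i * scaleDensity lam mu (i + k) := by
    intro k
    induction k with
    | zero =>
      have := hr0 i
      rw [add_zero]
      field_simp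
      exact hd.symm
    | succ k ih =>
      have h1 := hu (i + k + 1) (by omega)
      have h2 := hpq (i + k + 1)
      have h3 := jumpProb_mul_scaleDensity (mu := mu) hlam (i + k)
      simp only [average, Nat.add_sub_cancel] at h1 h2
      refine mul_left_cancel₀ (hp (i + k + 1)).ne' ?_
      rw [← add_assoc]
      linear_combination -h1 - u (i + k + 1) * h2 + jumpProb lam mu (i + k + 1) (i + k) * ih
        - d / scaleDensity lam mu i * h3
  have hsum : ∀ n, u (i + n) = u i
      + d / scaleDensity lam mu i * ∑ k ∈ Finset.range n, scaleDensity lam mu (i + k) := by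
    intro n
    induction n with
    | zero => simp
    | succ n ih =>
      rw [Finset.sum_range_succ, ← add_assoc]
      linear_combination ih + hincr n
  have hd0 : 0 ≤ d := by
    by_contra hneg
    have : b * jumpProb lam mu i (i + 1) * d < 0 :=
      mul_neg_of_pos_of_neg (mul_pos hb0 (hp i)) (not_le.1 hneg)
    nlinarith [hu0 i]
  have hdz : d = 0 := by
    by_contra hne
    have hdpos : 0 < d / scaleDensity lam mu i :=
      div_pos (lt_of_le_of_ne hd0 (Ne.symm hne)) (hr0 i)
    refine hr ((summable_nat_add_iff i).1 ?_)
    refine summable_of_sum_range_le (c := 1 / (d / scaleDensity lam mu i))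
      (fun n => (hr0 _).le) fun n => ?_
    rw [le_div_iff₀ hdpos]
    have h1 := hsum n
    simp only [add_comm i] at h1
    have h2 := hu1 (n + i)
    have h3 := hu0 i
    linarith
  have hi : u i = 0 := by
    rw [hdz, mul_zero] at hdi
    rcases mul_eq_zero.1 hdi.symm with h | h
    · linarith
    · exact h
  rcases le_total z i with h | h
  · rw [hbelow' z h, hi]
  · obtain ⟨n, rfl⟩ := Nat.exists_eq_add_of_le h
    rw [hsum, hdz, hi]
    simp

/-- Survival probabilities of the killed jump chain tend to `0`, if the scale function is
unbounded. -/
lemma tendsto_iterate_killed (hlam : ∀ n, 0 < lam n) (hmu : ∀ n, 1 ≤ n → 0 < mu n)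
    (hr : ¬ Summable (scaleDensity lam mu)) {i : ℕ} {b : ℝ} (hb0 : 0 < b) (hb1 : b < 1)
    {w : ℕ → ℝ} (hwi : w i = b) (hw : ∀ z, z ≠ i → w z = 1) {v : ℕ → ℕ → ℝ}
    (hv0 : ∀ z, v 0 z = 1) (hv : ∀ N z, v (N + 1) z = average lam mu (fun z => w z * v N z) z) :
    (∀ N z, 0 ≤ v N z) ∧ (∀ N z, v N z ≤ 1) ∧ ∀ z, Tendsto (fun N => v N z) atTop (𝓝 0) := by
  have hw0 : ∀ z, 0 ≤ w z := fun z => by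
    by_cases h : z = i
    · rw [h, hwi]; exact hb0.le
    · rw [hw z h]; exact zero_le_one
  have hw1 : ∀ z, w z ≤ 1 := fun z => by
    by_cases h : z = i
    · rw [h, hwi]; exact hb1.le
    · rw [hw z h]
  have hnn : ∀ N z, 0 ≤ v N z := by
    intro N
    induction N with
    | zero => intro z; rw [hv0]; exact zero_le_one
    | succ N ih =>
      intro z
      rw [hv]
      exact average_nonneg hlam hmu (fun z => mul_nonneg (hw0 z) (ih z)) z
  have hanti : ∀ N z, v (N + 1) z ≤ v N z := by
    intro N
    induction N with
    | zero =>
      intro z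
      rw [hv, hv0, ← average_one hlam hmu z]
      exact average_mono hlam hmu (fun z => by simpa [hv0] using hw1 z) z
    | succ N ih =>
      intro z
      rw [hv, hv N]
      exact average_mono hlam hmu (fun z => mul_le_mul_of_nonneg_left (ih z) (hw0 z)) z
  have hle : ∀ N z, v N z ≤ 1 := fun N z =>
    (antitone_nat_of_succ_le (f := fun N => v N z) (fun N => hanti N z) (Nat.zero_le N)).trans
      (hv0 z).le
  refine ⟨hnn, hle, ?_⟩
  have hlim : ∀ z, ∃ l, Tendsto (fun N => v N z) atTop (𝓝 l) := fun z =>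
    ⟨_, tendsto_atTop_ciInf (antitone_nat_of_succ_le fun N => hanti N z)
      ⟨0, by rintro _ ⟨N, rfl⟩; exact hnn N z⟩⟩
  choose l hl using hlim
  have hl0 : ∀ z, 0 ≤ l z := fun z => ge_of_tendsto' (hl z) fun N => hnn N z
  have hl1 : ∀ z, l z ≤ 1 := fun z => le_of_tendsto' (hl z) fun N => hle N z
  have hfix : ∀ z, l z = average lam mu (fun z => w z * l z) z := fun z => by
    refine tendsto_nhds_unique ((hl z).comp (tendsto_add_atTop_nat 1)) ?_
    refine Tendsto.congr (fun N => (hv N z).symm) ?_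
    exact (((hl _).const_mul _).const_mul _).add (((hl _).const_mul _).const_mul _)
  -- The limit `l` does not count killing at the current state; the product `w * l` does, and it is
  -- this function that satisfies the killed harmonic equations.
  have hu : ∀ z, w z * l z = 0 := by
    refine eq_zero_of_killed_harmonic (i := i) hlam hmu hr hb0 hb1
      (fun z => mul_nonneg (hw0 z) (hl0 z)) (fun z => mul_le_one₀ (hw1 z) (hl0 z) (hl1 z)) ?_ ?_
    · rw [← hfix, hwi]
    · intro z hz
      rw [← hfix, hw z hz, one_mul]
  intro z
  have : l z = 0 := by
    rw [hfix]
    simp [average, hu]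
  exact this ▸ hl z

/-- The Green function of the jump chain, up to a factor. -/
def potential (lam mu : ℕ → ℝ) (i n : ℕ) : ℝ := ∑' m, scaleDensity lam mu (m + max n i)

/-- Equality holds: the potential is constant up to `i` and a tail of the scale series beyond, so it
is harmonic off `i`, and at `i` a step upwards loses `scaleDensity lam mu i`. -/
lemma average_potential_add_le (hlam : ∀ n, 0 < lam n) (hmu : ∀ n, 1 ≤ n → 0 < mu n)
    (hr : Summable (scaleDensity lam mu)) (i z : ℕ) :
    average lam mu (potential lam mu i) z +
      (if z = i then jumpProb lam mu i (i + 1) * scaleDensity lam mu i else 0)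
      ≤ potential lam mu i z := by
  have hpq := jumpProb_add hlam hmu z
  have hstep : ∀ n, i ≤ n →
      potential lam mu i n = scaleDensity lam mu n + potential lam mu i (n + 1) := by
    intro n hn
    rw [potential, potential, max_eq_left hn, max_eq_left (by omega),
      ((summable_nat_add_iff n).2 hr).tsum_eq_zero_add, zero_add]
    congr 1
    exact tsum_congr fun m => by congr 1; ring
  have hlow : ∀ n, n ≤ i → potential lam mu i n = potential lam mu i i := by
    intro n hn
    rw [potential, potential, max_eq_right hn, max_self]
  refine le_of_eq ?_
  rw [average]
  rcases lt_trichotomy z i with h | rfl | h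
  · rw [hlow z h.le, hlow (z + 1) h, hlow (z - 1) (by omega), if_neg h.ne]
    linear_combination potential lam mu i i * hpq
  · rw [hlow (z - 1) (by omega), if_pos rfl]
    linear_combination potential lam mu z z * hpq
      - jumpProb lam mu z (z + 1) * hstep z le_rfl
  · obtain ⟨n, rfl⟩ : ∃ n, z = n + 1 := ⟨z - 1, by omega⟩
    rw [if_neg h.ne', Nat.add_sub_cancel]
    have h1 := hstep (n + 1) (by omega)
    have h2 := hstep n (by omega)
    have h3 := jumpProb_mul_scaleDensity (mu := mu) hlam n
    rw [Nat.add_sub_cancel] at hpq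
    linear_combination potential lam mu i (n + 1) * hpq
      - jumpProb lam mu (n + 1) (n + 1 + 1) * h1 + jumpProb lam mu (n + 1) n * h2 - h3

/-! ### Almost sure behaviour of the visits -/

namespace IsJumpData

open IsMarking

variable {Ω : Type*} [MeasurableSpace Ω] {P : Measure Ω} {Y : ℕ → Ω → ℕ} {S : ℕ → Ω → ℝ} {i : ℕ}

lemma isMarking_pos [IsProbabilityMeasure P] (hlam : ∀ n, 0 < lam n)
    (hmu : ∀ n, 1 ≤ n → 0 < mu n) (hJ : IsJumpData lam mu i P Y S) :
    IsMarking lam mu i P Y (fun k => {ω | 0 < S k ω}) (fun _ _ => 1) := by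
  simpa using hJ.isMarking hlam hmu ∅

/-- With all weights equal to `1` the transition operator preserves total mass, so the events of
positivity up to time `n` have probability `1`. -/
lemma ae_holding_pos [IsProbabilityMeasure P] (hlam : ∀ n, 0 < lam n)
    (hmu : ∀ n, 1 ≤ n → 0 < mu n) (hJ : IsJumpData lam mu i P Y S) :
    ∀ᵐ ω ∂P, ∀ k, 0 < S k ω := by
  have hE := hJ.isMarking_pos hlam hmu
  have h1 : ∀ n, ∑' z, stateMass P Y (fun k => {ω | 0 < S k ω}) n z * ENNReal.ofReal 1 = 1 := by
    intro n
    induction n with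
    | zero => rw [hE.tsum_stateMass_zero_mul fun _ => 1]; simp
    | succ n ih =>
      rw [hE.tsum_stateMass_succ_mul hlam hmu (g := fun _ => 1) fun _ => zero_le_one]
      simpa [average_one hlam hmu] using ih
  rw [ae_all_iff]
  intro n
  have h2 := h1 n
  simp only [ENNReal.ofReal_one, mul_one] at h2
  rw [hE.tsum_stateMass] at h2
  have h3 := (mem_ae_iff_prob_eq_one (hE.measurableSet_forall n)).2 h2
  filter_upwards [h3] with ω hω
  exact hω n le_rfl

/-- If the scale function is bounded, the jump chain visits its starting point finitely often. -/
lemma ae_finite_visits [IsProbabilityMeasure P] (hlam : ∀ n, 0 < lam n)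
    (hmu : ∀ n, 1 ≤ n → 0 < mu n) (hJ : IsJumpData lam mu i P Y S)
    (hr : Summable (scaleDensity lam mu)) : ∀ᵐ ω ∂P, ∀ᶠ n in atTop, Y n ω ≠ i := by
  have hE := hJ.isMarking_pos hlam hmu
  set E : ℕ → Set Ω := fun k => {ω | 0 < S k ω}
  set f := potential lam mu i with hf
  have hf0 : ∀ z, 0 ≤ f z := fun z => tsum_nonneg fun m => (scaleDensity_pos hlam hmu _).le
  set ε := jumpProb lam mu i (i + 1) * scaleDensity lam mu i with hε
  have hε0 : 0 < ε := mul_pos (jumpProb_succ_pos hlam hmu i) (scaleDensity_pos hlam hmu i)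
  -- The expected potential drops by `ε` times the probability of being in `i`; summation bounds the
  -- expected number of visits by `f i / ε`.
  have hstep : ∀ n, ∑' z, stateMass P Y E (n + 1) z * ENNReal.ofReal (f z)
      + stateMass P Y E n i * ENNReal.ofReal ε
      ≤ ∑' z, stateMass P Y E n z * ENNReal.ofReal (f z) := by
    intro n
    rw [hE.tsum_stateMass_succ_mul hlam hmu hf0]
    have h1 : stateMass P Y E n i * ENNReal.ofReal ε
        = ∑' z, stateMass P Y E n z * ENNReal.ofReal (if z = i then ε else 0) := by
      rw [tsum_eq_single i fun z hz => by simp [hz]]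
      simp
    rw [h1, ← ENNReal.tsum_add]
    refine ENNReal.tsum_le_tsum fun z => ?_
    simp only [one_mul]
    rw [← mul_add, ← ENNReal.ofReal_add (average_nonneg hlam hmu hf0 z)
      (by split_ifs <;> positivity)]
    gcongr
    exact average_potential_add_le hlam hmu hr i z
  have hsum : ∀ N, ∑' z, stateMass P Y E N z * ENNReal.ofReal (f z)
      + (∑ n ∈ Finset.range N, stateMass P Y E n i) * ENNReal.ofReal ε ≤ ENNReal.ofReal (f i) := by
    intro N
    induction N with
    | zero => rw [hE.tsum_stateMass_zero_mul]; simp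
    | succ N ih =>
      rw [Finset.sum_range_succ, add_mul, add_comm (_ * _) (_ * _), ← add_assoc]
      exact (add_le_add_left (hstep N) _).trans ih
  have hfin : ∑' n, stateMass P Y E n i ≠ ⊤ := by
    have h : ∑' n, stateMass P Y E n i ≤ ENNReal.ofReal (f i) / ENNReal.ofReal ε := by
      refine ENNReal.tsum_le_of_sum_range_le fun N => ?_
      rw [ENNReal.le_div_iff_mul_le (Or.inl (by simpa using hε0)) (Or.inl ENNReal.ofReal_ne_top)]
      exact le_add_self.trans (hsum N)
    exact ne_top_of_le_ne_top (ENNReal.div_ne_top ENNReal.ofReal_ne_top (by simpa using hε0)) h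
  have hbc := ae_eventually_notMem hfin
  filter_upwards [hbc, hJ.ae_holding_pos hlam hmu] with ω h1 h2
  filter_upwards [h1] with n hn hY
  exact hn ⟨fun k _ => h2 k, hY⟩

/-- If the scale function is unbounded, the jump chain returns to its starting point infinitely
often with a holding time longer than `1`. -/
lemma ae_frequently_long_visit [IsProbabilityMeasure P] (hlam : ∀ n, 0 < lam n)
    (hmu : ∀ n, 1 ≤ n → 0 < mu n) (hJ : IsJumpData lam mu i P Y S)
    (hr : ¬ Summable (scaleDensity lam mu)) :
    ∀ᵐ ω ∂P, ∀ m, ∃ k, m < k ∧ Y k ω = i ∧ 1 < S k ω := by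
  classical
  have hq := exitRate_pos hlam hmu i
  have key : ∀ m, ∀ᵐ ω ∂P, ¬ ∀ k, 0 < S k ω ∧ (k ∈ {k | m < k} → Y k ω = i → S k ω ≤ 1) := by
    intro m
    have hE := hJ.isMarking hlam hmu {k | m < k}
    set E : ℕ → Set Ω := fun k => {ω | 0 < S k ω ∧ (k ∈ {k | m < k} → Y k ω = i → S k ω ≤ 1)}
     
    -- `v N z` is the probability of surviving the next `N` arrivals from `z`, with caps in force
    -- only after time `m`.
    let v : ℕ → ℕ → ℝ := fun N => Nat.rec (fun _ => 1)
      (fun _ g => average lam mu fun z => capWeight lam mu i z * g z) N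
    obtain ⟨hv0, hv1, hvt⟩ := tendsto_iterate_killed (v := v) (w := capWeight lam mu i) hlam hmu hr
      (i := i) (b := 1 - Real.exp (-exitRate lam mu i))
      (by rw [sub_pos, Real.exp_lt_one_iff]; linarith)
      (by linarith [Real.exp_pos (-exitRate lam mu i)])
      (by simp [capWeight]) (fun z hz => by simp [capWeight, hz]) (fun _ => rfl) (fun _ _ => rfl)
    have hshift : ∀ N j, ∑' z, stateMass P Y E (m + N) z * ENNReal.ofReal (v j z)
        = ∑' z, stateMass P Y E m z * ENNReal.ofReal (v (N + j) z) := by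
      intro N
      induction N with
      | zero => intro j; simp
      | succ N ih =>
        intro j
        rw [← add_assoc, hE.tsum_stateMass_succ_mul hlam hmu (hv0 j), add_right_comm N 1 j]
        have : m + N + 1 ∈ {k | m < k} := by simp only [Set.mem_ofPred_eq]; omega
        simp only [this, if_true]
        exact ih (j + 1)
    have hbound : ∀ N, P {ω | ∀ k, ω ∈ E k}
        ≤ ∑' z, stateMass P Y E m z * ENNReal.ofReal (v N z) := by
      intro N
      have h := hshift N 0
      rw [add_zero] at h
      rw [← h]
      have h1 : ∀ z, ENNReal.ofReal (v 0 z) = 1 := fun z => by simp [v]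
      simp only [h1, mul_one]
      rw [hE.tsum_stateMass]
      exact measure_mono fun ω hω k _ => hω k
    have hlim : Tendsto (fun N => ∑' z, stateMass P Y E m z * ENNReal.ofReal (v N z)) atTop
        (𝓝 0) := by
      have hfin : ∑' z, stateMass P Y E m z ≠ ⊤ := by
        rw [hE.tsum_stateMass]
        exact measure_ne_top _ _
      have h := tendsto_lintegral_of_dominated_convergence (μ := Measure.count)
        (F := fun N z => stateMass P Y E m z * ENNReal.ofReal (v N z)) (f := fun _ => 0)
        (stateMass P Y E m) (fun N => measurable_of_countable _)
        (fun N => Eventually.of_forall fun z =>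
          mul_le_of_le_one_right' (ENNReal.ofReal_le_one.2 (hv1 N z)))
        (by rwa [lintegral_count])
        (Eventually.of_forall fun z => by
          have h1 := ENNReal.tendsto_ofReal (hvt z)
          rw [ENNReal.ofReal_zero] at h1
          have := ENNReal.Tendsto.const_mul (a := stateMass P Y E m z) h1
            (Or.inr (measure_ne_top _ _))
          rwa [mul_zero] at this)
      simpa [lintegral_count] using h
    have hzero : P {ω | ∀ k, ω ∈ E k} = 0 :=
      le_antisymm (ge_of_tendsto' hlim hbound) zero_le
    rw [ae_iff]
    simp only [not_not]
    exact hzero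
  filter_upwards [ae_all_iff.2 key, hJ.ae_holding_pos hlam hmu] with ω h1 h2 m
  by_contra! hcon
  exact h1 m fun k => ⟨h2 k, fun hk hY => hcon k hk hY⟩

end IsJumpData

/-! ### From the jump chain to the process -/

lemma jumpTime_succ {Ω : Type*} (S : ℕ → Ω → ℝ) (n : ℕ) (ω : Ω) :
    jumpTime S (n + 1) ω = jumpTime S n ω + S n ω :=
  Finset.sum_range_succ _ _

variable {Ω : Type*} [MeasurableSpace Ω] {P : ℕ → Measure Ω} [∀ i, IsProbabilityMeasure (P i)]
  {X : ℝ≥0 → Ω → WithTop ℕ}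

theorem isTransient_of_summable (hlam : ∀ n, 0 < lam n) (hmu : ∀ n, 1 ≤ n → 0 < mu n)
    (hX : IsBirthDeathProcess lam mu P X) (hr : Summable (scaleDensity lam mu)) :
    IsTransient P X := by
  intro i
  obtain ⟨Y, S, hJ, hXY⟩ := hX i
  filter_upwards [hXY, hJ.ae_finite_visits hlam hmu hr, hJ.ae_holding_pos hlam hmu]
    with ω hω hfin hpos
  obtain ⟨N, hN⟩ := eventually_atTop.1 hfin
  have hmono : Monotone fun n => jumpTime S n ω :=
    monotone_nat_of_le_succ fun n => by rw [jumpTime_succ]; linarith [hpos n]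
  refine ⟨(jumpTime S N ω).toNNReal, fun t ht => ?_⟩
  -- Being in `i` rather than in the cemetery places `t` before explosion, so non-explosion is not
  -- needed here.
  have hex : ∃ n, (t : ℝ) < jumpTime S n ω := by
    by_contra! hcon
    have := (hω t).2 hcon
    rw [Set.mem_ofPred_eq, this] at ht
    exact WithTop.top_ne_coe ht
  classical
  have hlt := Nat.find_spec hex
  obtain ⟨n, hn⟩ : ∃ n, Nat.find hex = n + 1 := by
    refine Nat.exists_eq_succ_of_ne_zero fun h0 => ?_
    rw [h0] at hlt
    simp only [jumpTime, Finset.range_zero, Finset.sum_empty] at hlt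
    exact absurd t.2 (not_le.2 hlt)
  rw [hn] at hlt
  have hle : jumpTime S n ω ≤ t := not_lt.1 (Nat.find_min hex (by omega))
  have hXt := (hω t).1 n hle hlt
  rw [Set.mem_ofPred_eq, hXt] at ht
  have hYn : Y n ω = i := by exact_mod_cast ht
  have hnN : n + 1 ≤ N := by
    by_contra h
    exact hN n (by omega) hYn
  exact NNReal.le_toNNReal_of_coe_le (hlt.le.trans (hmono hnN))

theorem isRecurrent_of_not_summable (hlam : ∀ n, 0 < lam n) (hmu : ∀ n, 1 ≤ n → 0 < mu n)
    (hX : IsBirthDeathProcess lam mu P X) (hr : ¬ Summable (scaleDensity lam mu)) :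
    IsRecurrent P X := by
  intro i
  obtain ⟨Y, S, hJ, hXY⟩ := hX i
  filter_upwards [hXY, hJ.ae_frequently_long_visit hlam hmu hr, hJ.ae_holding_pos hlam hmu]
    with ω hω hvis hpos
  have hmono : Monotone fun n => jumpTime S n ω :=
    monotone_nat_of_le_succ fun n => by rw [jumpTime_succ]; linarith [hpos n]
  -- Each long visit adds more than `1` to the jump times, so they are unbounded and the later
  -- visits occur at arbitrarily large times.
  have hlarge : ∀ N : ℕ, ∃ n, (N : ℝ) ≤ jumpTime S n ω := by
    intro N
    induction N with
    | zero => exact ⟨0, by simp [jumpTime]⟩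
    | succ N ih =>
      obtain ⟨n, hn⟩ := ih
      obtain ⟨k, hk, -, hS⟩ := hvis n
      refine ⟨k + 1, ?_⟩
      have := hmono hk.le
      rw [jumpTime_succ]
      push_cast
      simp only at this
      linarith
  rintro ⟨B, hB⟩
  obtain ⟨N, hN⟩ := exists_nat_gt (B : ℝ)
  obtain ⟨n, hn⟩ := hlarge N
  obtain ⟨k, hk, hY, -⟩ := hvis n
  have hk' : jumpTime S n ω ≤ jumpTime S k ω := hmono hk.le
  have h0 : 0 ≤ jumpTime S k ω := Finset.sum_nonneg fun j _ => (hpos j).le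
  have hXt := (hω ⟨jumpTime S k ω, h0⟩).1 k le_rfl
    (by rw [jumpTime_succ]; exact lt_add_of_pos_right _ (hpos k))
  rw [hY] at hXt
  have hle : jumpTime S k ω ≤ (B : ℝ) := hB hXt
  linarith

end BirthDeath

end

theorem theorem3 {Ω : Type*} [MeasurableSpace Ω] (lam mu : ℕ → ℝ)
    (hlam : ∀ n, 0 < lam n) (hmu : ∀ n, 1 ≤ n → 0 < mu n)
    (P : ℕ → Measure Ω) [∀ i, IsProbabilityMeasure (P i)] (X : ℝ≥0 → Ω → WithTop ℕ)
    (hX : BirthDeath.IsBirthDeathProcess lam mu P X) :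
    ((∃ c : ℝ, 1 < c ∧ ∃ K : ℕ, 1 ≤ K ∧ ∃ n₀ : ℕ, ∀ n : ℕ, n₀ < n →
        1 + 1 / (n : ℝ)
          + 1 / (n : ℝ) * ∑ k ∈ Finset.Icc 1 (K - 1), 1 / BirthDeath.logProd k (n : ℝ)
          + c / ((n : ℝ) * BirthDeath.logProd K (n : ℝ)) ≤ lam n / mu n) →
      BirthDeath.IsTransient P X) ∧
    ((∃ K : ℕ, 1 ≤ K ∧ ∃ n₀ : ℕ, ∀ n : ℕ, n₀ < n →
        lam n / mu n ≤ 1 + 1 / (n : ℝ)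
          + 1 / (n : ℝ) * ∑ k ∈ Finset.Icc 1 K, 1 / BirthDeath.logProd k (n : ℝ)) →
      BirthDeath.IsRecurrent P X) := by
  refine ⟨?_, ?_⟩
  · rintro ⟨c, hc, K, hK, n₀, h⟩
    exact BirthDeath.isTransient_of_summable hlam hmu hX
      (BirthDeath.summable_scaleDensity hlam hmu hc hK h)
  · rintro ⟨K, -, n₀, h⟩
    exact BirthDeath.isRecurrent_of_not_summable hlam hmu hX
      (BirthDeath.not_summable_scaleDensity hlam hmu h)
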